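/- Let $\pi\colon\mathbb{R}\to\mathbb{R}/\mathbb{Z}$ denote the projection. A *limit value* of a sequence in $\mathbb{R}/\mathbb{Z}$ is the limit of a convergent subsequence. A *Pisot number* is a real algebraic integer $\beta>1$ all of whose Galois conjugates in $\mathbb{C}$ other than $\beta$ have modulus strictly less than $1$. Let $\alpha$ be a real algebraic number with $|\alpha|>1$, and let $F(x),G(x)\in\mathbb{R}[x]$ with $F(x)$ nonzero. Then the set $E$ of limit values of the sequence $(\pi(F(k)\alpha^k+G(k)))_{k\ge 1}$ is finite if and only if $|\alpha|$ is a Pisot number, $F(x)\in\mathbb{Q}(\alpha)[x]$, and $G(x)-G(0)\in\mathbb{Q}[x]$. Moreover, if $G(x)-G(0)\notin\mathbb{Q}[x]$, then $E$ is uncountable. -/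

import Mathlib

open Filter Polynomial

/-- The set of limit values of a sequence `u` in a topological space: the points every
neighbourhood of which contains `u k` for infinitely many `k`. (In a metric space these are the
limits of the convergent subsequences of `u`.) -/
def limitValues {X : Type*} [TopologicalSpace X] (u : ℕ → X) : Set X :=
  {x | MapClusterPt x atTop u}

/-- A Pisot number: a real algebraic integer `β > 1` all of whose Galois conjugates in `ℂ` other
than `β` have modulus strictly less than `1`. The Galois conjugates are the complex roots of the
minimal polynomial of `β` over `ℚ`. -/
def IsPisot (β : ℝ) : Prop :=
  1 < β ∧ IsIntegral ℤ β ∧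
    ∀ z : ℂ, aeval z (minpoly ℚ β) = 0 → z ≠ (β : ℂ) → ‖z‖ < 1

/-! Integer polynomials in the shift `S` act on circle sequences and preserve finiteness and
countability of the set of limit values. Two such operators drive the proof. If the leading
coefficient of a nonconstant G is irrational, a suitable one kills F(k)α^k and reduces G to an
arithmetic progression with irrational difference, which accumulates everywhere
(`leadingCoeff_mem_range_of_countable`). Another reduces F(k)α^k to a geometric sequence ξα^k
(`leadingCoeff_mem_adjoin`). Descent on the degree then reaches the other coefficients.

In the geometric case, finiteness gives ξα^k = integer + finitely valued term + o(1). Let P be the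
minimal polynomial of α. Applying P(S) shows that the first two terms together eventually satisfy
the recurrence P and are rational with a common denominator D. So Dξα^k is eventually o(1)-close to
integers Y obeying P. Dividing P by X − z isolates the component of Y at each conjugate z of α. For
z ≠ α this component is nonzero and tends to 0, so |z| < 1 (`pisot_of_integer_recurrence`).

Conversely, for small conjugates the traces of α^k are integers exponentially close to α^k, which
absorbs any factor k^n (`HasSmallConjugates.exists_int_approx`). -/

/-- The shift operator `(u k) ↦ (u (k + 1))` on sequences in a module. -/
def shift (R A : Type*) [CommRing R] [AddCommGroup A] [Module R A] : Module.End R (ℕ → A) :=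
  LinearMap.funLeft R A Nat.succ

/-! ### Polynomials in the shift acting on sequences. -/

section Shift

variable {R A : Type*} [CommRing R] [AddCommGroup A] [Module R A]

@[simp] lemma shift_apply (u : ℕ → A) (k : ℕ) : shift R A u k = u (k + 1) := rfl

lemma shift_pow_apply (n : ℕ) (u : ℕ → A) (k : ℕ) : (shift R A ^ n) u k = u (k + n) := by
  induction n generalizing k with
  | zero => simp
  | succ n ih =>
    rw [pow_succ', Module.End.mul_apply, shift_apply, ih]
    congr 1
    ring

lemma aeval_shift_apply (p : R[X]) (u : ℕ → A) (k : ℕ) :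
    aeval (shift R A) p u k = p.sum fun i c => c • u (k + i) := by
  rw [aeval_eq_sum_range, sum_over_range _ (by simp)]
  simp [LinearMap.sum_apply, Finset.sum_apply, shift_pow_apply]

/-- A class of sequences which is closed under sums, scalars and the shift is closed under
polynomials in the shift. -/
lemma aeval_shift_induction {Q : (ℕ → A) → Prop} (hadd : ∀ u v, Q u → Q v → Q (u + v))
    (hsmul : ∀ (c : R) u, Q u → Q (c • u)) (hshift : ∀ u, Q u → Q (shift R A u))
    (p : R[X]) {u : ℕ → A} (hu : Q u) : Q (aeval (shift R A) p u) := by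
  induction p using Polynomial.induction_on' with
  | add p q hp hq => simpa using hadd _ _ hp hq
  | monomial n c =>
    rw [aeval_monomial, Module.End.mul_apply, Module.algebraMap_end_apply]
    apply hsmul
    induction n with
    | zero => simpa
    | succ n ih => rw [pow_succ', Module.End.mul_apply]; exact hshift _ ih

/-- Transports recurrences along casts, field embeddings and ℚ-linear maps of the values. -/
lemma aeval_shift_map {R' B : Type*} [CommRing R'] [AddCommGroup B] [Module R' B] (φ : R →+* R')
    (f : A →+ B) (hf : ∀ r a, f (r • a) = φ r • f a) (p : R[X]) (u : ℕ → A) :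
    aeval (shift R' B) (p.map φ) (fun k => f (u k)) = fun k => f (aeval (shift R A) p u k) := by
  induction p using Polynomial.induction_on' with
  | add p q hp hq => ext k; simp [hp, hq]
  | monomial n c =>
    ext k
    simp [aeval_monomial, Module.algebraMap_end_apply, shift_pow_apply, hf]

lemma aeval_shift_geom (p : R[X]) (c z : R) :
    aeval (shift R R) p (fun k => c * z ^ k) = fun k => c * p.eval z * z ^ k := by
  ext k
  rw [aeval_shift_apply, eval_eq_sum, sum_over_range _ (by simp), sum_over_range _ (by simp),
    Finset.mul_sum, Finset.sum_mul]
  refine Finset.sum_congr rfl fun i _ => ?_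
  simp only [smul_eq_mul]
  ring

lemma aeval_shift_tendsto_zero [TopologicalSpace A] [IsTopologicalAddGroup A]
    [ContinuousConstSMul R A] (p : R[X]) {u : ℕ → A} (hu : Tendsto u atTop (nhds 0)) :
    Tendsto (aeval (shift R A) p u) atTop (nhds 0) := by
  refine aeval_shift_induction (Q := fun u => Tendsto u atTop (nhds 0)) ?_ ?_ ?_ p hu
  · intro u v hu hv
    rw [← add_zero (0 : A)]
    exact hu.add hv
  · intro c u hu
    rw [← smul_zero c]
    exact hu.const_smul c
  · intro u hu
    exact (tendsto_add_atTop_iff_nat 1).2 hu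

lemma aeval_shift_comp_add (p : R[X]) (u : ℕ → A) (n : ℕ) :
    aeval (shift R A) p (fun k => u (n + k)) = fun k => aeval (shift R A) p u (n + k) := by
  ext k
  simp only [aeval_shift_apply, add_assoc]

/-- A sequence killed by a nonzero polynomial of degree `d` in the shift vanishes when `d`
consecutive terms do. -/
lemma eq_zero_of_aeval_shift_eq_zero [IsDomain R] [Module.IsTorsionFree R A] {p : R[X]}
    (hp : p ≠ 0) {u : ℕ → A} (hu : aeval (shift R A) p u = 0)
    (h0 : ∀ i < p.natDegree, u i = 0) : u = 0 := by
  ext k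
  induction k using Nat.strong_induction_on with
  | _ k ih =>
    rcases lt_or_ge k p.natDegree with hk | hk
    · exact h0 k hk
    · obtain ⟨j, rfl⟩ := Nat.exists_eq_add_of_le' hk
      have h := congrFun hu j
      rw [aeval_shift_apply, sum_over_range _ (by simp), Finset.sum_range_succ,
        Finset.sum_eq_zero, zero_add] at h
      · exact (smul_eq_zero.1 h).resolve_left (by simpa using hp)
      · intro i hi
        rw [ih (j + i) (by have := Finset.mem_range.1 hi; omega)]
        simp

/-- The relation `S u = z u` for the shift `S` characterises geometric progressions. -/
lemma eq_geom_of_aeval_shift_X_sub_C {u : ℕ → R} {z : R}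
    (hu : aeval (shift R R) (X - C z) u = 0) (k : ℕ) : u k = u 0 * z ^ k := by
  induction k with
  | zero => simp
  | succ k ih =>
    have h := congrFun hu k
    simp [Module.algebraMap_end_apply, sub_eq_zero] at h
    rw [h, ih]
    ring

end Shift

/-! ### Limit values and compactness. -/

section LimitValues

variable {X : Type*} [TopologicalSpace X]

lemma limitValues_subset_of_tendsto [T2Space X] {u : ℕ → X} {a : X}
    (h : Tendsto u atTop (nhds a)) : limitValues u ⊆ {a} := by
  intro x hx
  obtain ⟨U, hU, hx⟩ := mapClusterPt_iff_ultrafilter.1 hx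
  exact tendsto_nhds_unique hx (h.mono_left hU)

lemma limitValues_shift_subset (u : ℕ → X) : limitValues (fun k => u (k + 1)) ⊆ limitValues u := by
  intro x hx
  exact MapClusterPt.of_comp (tendsto_add_atTop_nat 1) hx

/-- An ultrafilter along which the image converges also converges upstairs, by compactness of the
source. -/
lemma limitValues_comp_subset [CompactSpace X] {Y : Type*} [TopologicalSpace Y] [T2Space Y]
    {f : X → Y} (hf : Continuous f) (u : ℕ → X) :
    limitValues (fun k => f (u k)) ⊆ f '' limitValues u := by
  intro x hx
  obtain ⟨U, hU, hx⟩ := mapClusterPt_iff_ultrafilter.1 hx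
  obtain ⟨a, -, ha⟩ := isCompact_univ.ultrafilter_le_nhds (U.map u) (by simp)
  exact ⟨a, mapClusterPt_iff_ultrafilter.2 ⟨U, hU, ha⟩,
    tendsto_nhds_unique ((hf.tendsto a).comp ha) hx⟩

lemma limitValues_prodMk_subset {Y : Type*} [TopologicalSpace Y] (u : ℕ → X) (v : ℕ → Y) :
    limitValues (fun k => (u k, v k)) ⊆ limitValues u ×ˢ limitValues v := fun _ hx =>
  ⟨MapClusterPt.continuousAt_comp (f := Prod.fst) continuous_fst.continuousAt hx,
    MapClusterPt.continuousAt_comp (f := Prod.snd) continuous_snd.continuousAt hx⟩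

lemma eventually_mem_of_limitValues_subset [CompactSpace X] {u : ℕ → X} {W : Set X}
    (hW : IsOpen W) (h : limitValues u ⊆ W) : ∀ᶠ k in atTop, u k ∈ W := by
  by_contra hne
  have hne : ∃ᶠ k in atTop, u k ∈ Wᶜ := by simpa [Filter.Frequently] using hne
  obtain ⟨x, hxW, hx⟩ := hW.isClosed_compl.isCompact.exists_mapClusterPt_of_frequently hne
  exact hxW (h hx)

end LimitValues

/-! ### Sequences on the circle. -/

section Circle

lemma limitValues_add_subset (u v : ℕ → UnitAddCircle) :
    limitValues (u + v) ⊆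
      (fun x : UnitAddCircle × UnitAddCircle => x.1 + x.2) '' (limitValues u ×ˢ limitValues v) :=
  (limitValues_comp_subset (f := fun x : UnitAddCircle × UnitAddCircle => x.1 + x.2)
    (by fun_prop) (fun k => (u k, v k))).trans
    (Set.image_mono (limitValues_prodMk_subset u v))

lemma limitValues_zsmul_subset (c : ℤ) (u : ℕ → UnitAddCircle) :
    limitValues (c • u) ⊆ (fun x => c • x) '' limitValues u :=
  limitValues_comp_subset (by fun_prop) u

lemma finite_limitValues_add {u v : ℕ → UnitAddCircle} (hu : (limitValues u).Finite)
    (hv : (limitValues v).Finite) : (limitValues (u + v)).Finite :=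
  ((hu.prod hv).image _).subset (limitValues_add_subset u v)

lemma countable_limitValues_add {u v : ℕ → UnitAddCircle} (hu : (limitValues u).Countable)
    (hv : (limitValues v).Countable) : (limitValues (u + v)).Countable :=
  ((hu.prod hv).image _).mono (limitValues_add_subset u v)

lemma finite_limitValues_zsmul (c : ℤ) {u : ℕ → UnitAddCircle} (hu : (limitValues u).Finite) :
    (limitValues (c • u)).Finite :=
  (hu.image _).subset (limitValues_zsmul_subset c u)

lemma finite_limitValues_neg {u : ℕ → UnitAddCircle} (hu : (limitValues u).Finite) :
    (limitValues (-u)).Finite := by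
  simpa using finite_limitValues_zsmul (-1) hu

lemma finite_limitValues_aeval_shift (p : ℤ[X]) {u : ℕ → UnitAddCircle}
    (hu : (limitValues u).Finite) : (limitValues (aeval (shift ℤ UnitAddCircle) p u)).Finite :=
  aeval_shift_induction (Q := fun u => (limitValues u).Finite)
    (fun _ _ => finite_limitValues_add) (fun c _ => finite_limitValues_zsmul c)
    (fun u hu => hu.subset (limitValues_shift_subset u)) p hu

lemma countable_limitValues_aeval_shift (p : ℤ[X]) {u : ℕ → UnitAddCircle}
    (hu : (limitValues u).Countable) :
    (limitValues (aeval (shift ℤ UnitAddCircle) p u)).Countable :=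
  aeval_shift_induction (Q := fun u => (limitValues u).Countable)
    (fun _ _ => countable_limitValues_add)
    (fun c u hu => (hu.image _).mono (limitValues_zsmul_subset c u))
    (fun u hu => hu.mono (limitValues_shift_subset u)) p hu

lemma finite_preimage_nsmul {N : ℕ} (hN : N ≠ 0) (y : UnitAddCircle) :
    {x : UnitAddCircle | N • x = y}.Finite := by
  rcases Set.eq_empty_or_nonempty {x : UnitAddCircle | N • x = y} with h | ⟨x₀, hx₀⟩
  · simp [h]
  have hfin : {x : UnitAddCircle | N • x = 0}.Finite :=
    (AddCircle.finite_torsion (p := (1 : ℝ)) (Nat.pos_of_ne_zero hN))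
  refine (hfin.image (fun x => x + x₀)).subset fun x hx => ⟨x - x₀, ?_, by simp⟩
  simp only [Set.mem_ofPred_eq] at hx hx₀ ⊢
  simp [smul_sub, hx, hx₀]

/-- Multiplication by `N` has finite fibres, cosets of the `N`-torsion; this allows denominators to
be cleared. -/
lemma finite_limitValues_of_nsmul {N : ℕ} (hN : N ≠ 0) {u : ℕ → UnitAddCircle}
    (hu : (limitValues (fun k => N • u k)).Finite) : (limitValues u).Finite := by
  refine (hu.biUnion fun y _ => finite_preimage_nsmul hN y).subset fun x hx => ?_
  simp only [Set.mem_iUnion]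
  exact ⟨N • x, MapClusterPt.continuousAt_comp (f := fun x : UnitAddCircle => N • x)
    (by fun_prop : Continuous fun x : UnitAddCircle => N • x).continuousAt hx, rfl⟩

lemma aeval_shift_coe_circle (p : ℤ[X]) (u : ℕ → ℝ) :
    aeval (shift ℤ UnitAddCircle) p (fun k => (u k : UnitAddCircle)) =
      fun k => ((aeval (shift ℝ ℝ) (p.map (Int.castRingHom ℝ)) u k : ℝ) : UnitAddCircle) := by
  have h1 := aeval_shift_map (Int.castRingHom ℤ) (QuotientAddGroup.mk' (AddSubgroup.zmultiples (1:ℝ)))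
    (fun r a => by simp) p u
  have h2 := aeval_shift_map (Int.castRingHom ℝ) (AddMonoidHom.id ℝ)
    (fun r a => by simp) p u
  simp only [AddMonoidHom.id_apply] at h2
  rw [h2]
  simpa using h1

/-- An arithmetic progression on the circle with irrational difference accumulates everywhere. -/
lemma limitValues_rotation {v : ℕ → UnitAddCircle} {a : ℝ} (ha : Irrational a)
    (hv : ∀ k, v (k + 1) = v k + a) : limitValues v = Set.univ := by
  have hv' : ∀ k : ℕ, v k = v 0 + k • (a : UnitAddCircle) := by
    intro k
    induction k with
    | zero => simp
    | succ k ih => rw [hv, ih, succ_nsmul, add_assoc]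
  have hd : DenseRange (· • a : ℤ → UnitAddCircle) :=
    AddCircle.denseRange_zsmul_coe_iff.2 (by simpa using ha)
  refine Set.eq_univ_of_forall fun x => ?_
  have hx : MapClusterPt (x - v 0) atTop (fun k : ℕ => k • (a : UnitAddCircle)) := by
    rw [mapClusterPt_atTop_nsmul_iff_mem_topologicalClosure_zmultiples]
    exact hd (x - v 0)
  have h := MapClusterPt.continuousAt_comp (f := fun y => v 0 + y)
    (by fun_prop : Continuous fun y => v 0 + y).continuousAt hx
  rw [add_sub_cancel] at h
  have : v = (fun y => v 0 + y) ∘ fun k : ℕ => k • (a : UnitAddCircle) := funext hv'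
  rw [this]
  exact h

lemma not_countable_univ_circle : ¬ (Set.univ : Set UnitAddCircle).Countable := by
  intro h
  have : Countable UnitAddCircle := Set.countable_univ_iff.1 h
  have : Countable (Set.Ico (0:ℝ) (0 + 1)) := (AddCircle.equivIco (1:ℝ) 0).symm.injective.countable
  have h1 := Cardinal.mk_Ico_real (zero_lt_one' ℝ)
  have h2 := Cardinal.mk_le_aleph0 (α := Set.Ico (0:ℝ) (0 + 1))
  rw [zero_add, h1] at h2
  exact absurd h2 (not_le.2 Cardinal.aleph0_lt_continuum)

end Circle

/-! ### Integer sequences with a linear recurrence. -/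

/-- An integer sequence satisfying a linear recurrence over `ℚ` satisfies a monic linear
recurrence over `ℤ` (Fatou). -/
lemma exists_monic_aeval_shift_eq_zero {p : ℚ[X]} (hp : p ≠ 0) {Y : ℕ → ℤ}
    (hY : aeval (shift ℚ ℚ) p (fun k => (Y k : ℚ)) = 0) :
    ∃ Q : ℤ[X], Q.Monic ∧ aeval (shift ℤ ℤ) Q Y = 0 := by
  let W : Submodule ℤ (ℕ → ℤ) := LinearMap.ker
    ((aeval (shift ℚ ℚ) p).toAddMonoidHom.toIntLinearMap ∘ₗ
      (Int.castAddHom ℚ).toIntLinearMap.compLeft ℕ)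
  have hW : ∀ v : ℕ → ℤ, v ∈ W ↔ aeval (shift ℚ ℚ) p (fun k => (v k : ℚ)) = 0 := fun v => Iff.rfl
  have hS : ∀ v ∈ W, shift ℤ ℤ v ∈ W := by
    intro v hv
    rw [hW] at hv ⊢
    have h := aeval_shift_comp_add p (fun k => (v k : ℚ)) 1
    rw [hv] at h
    simp only [add_comm 1] at h
    exact h
  -- A solution is determined by its first `p.natDegree` terms, so the module `W` of integer
  -- solutions is finitely generated and Cayley–Hamilton over ℤ applies to the shift on it.
  let f : W →ₗ[ℤ] (Fin p.natDegree → ℤ) :=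
    LinearMap.funLeft ℤ ℤ (fun i : Fin p.natDegree => (i : ℕ)) ∘ₗ W.subtype
  have hf : Function.Injective f := by
    rw [injective_iff_map_eq_zero]
    rintro ⟨v, hv⟩ h
    have h0 : (fun k => (v k : ℚ)) = 0 :=
      eq_zero_of_aeval_shift_eq_zero hp ((hW v).1 hv) fun i hi => by
        have := congrFun h ⟨i, hi⟩
        have h2 : v i = 0 := this
        simp [h2]
    ext k
    have := congrFun h0 k
    simpa using this
  have : Module.Finite ℤ W := Module.Finite.of_injective f hf
  obtain ⟨Q, hQ, hQ0⟩ := LinearMap.exists_monic_and_aeval_eq_zero ℤ ((shift ℤ ℤ).restrict hS)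
  refine ⟨Q, hQ, ?_⟩
  have key : ∀ (q : ℤ[X]) (v : W),
      ((aeval ((shift ℤ ℤ).restrict hS) q v : W) : ℕ → ℤ) = aeval (shift ℤ ℤ) q (v : ℕ → ℤ) := by
    intro q v
    induction q using Polynomial.induction_on' with
    | add p q hp hq => simp [hp, hq]
    | monomial n c =>
      simp only [aeval_monomial, Module.End.mul_apply, Module.algebraMap_end_apply,
        Submodule.coe_smul]
      congr 1
      induction n with
      | zero => simp
      | succ n ih => rw [pow_succ', pow_succ', Module.End.mul_apply, Module.End.mul_apply, ← ih]; rfl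
  have := key Q ⟨Y, (hW Y).2 hY⟩
  rw [hQ0] at this
  exact this.symm

lemma norm_lt_one_of_tendsto_geom {𝕜 : Type*} [NormedField 𝕜] {c z : 𝕜} (hc : c ≠ 0)
    (h : Tendsto (fun k : ℕ => c * z ^ k) atTop (nhds 0)) : ‖z‖ < 1 := by
  rw [← tendsto_pow_atTop_nhds_zero_iff_norm_lt_one]
  simpa [hc] using h.const_mul c⁻¹

open IntermediateField in
/-- If `ξ α ^ k` is within `o(1)` of integers `Y k` satisfying the recurrence attached to `α`, then
`ξ ∈ ℚ(α)` and `α` is an algebraic integer whose other conjugates lie in the open unit disc. -/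
lemma pisot_of_integer_recurrence {α ξ : ℝ} (hα : IsAlgebraic ℚ α) (hα1 : 1 < |α|) (hξ : ξ ≠ 0)
    {Y : ℕ → ℤ} {δ : ℕ → ℝ} (hδ : Tendsto δ atTop (nhds 0)) (h : ∀ k, ξ * α ^ k = Y k + δ k)
    (hY : aeval (shift ℚ ℚ) (minpoly ℚ α) (fun k => (Y k : ℚ)) = 0) :
    ξ ∈ ℚ⟮α⟯ ∧ IsIntegral ℤ α ∧
      ∀ z : ℂ, aeval z (minpoly ℚ α) = 0 → z ≠ (α : ℂ) → ‖z‖ < 1 := by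
  have hint : IsIntegral ℚ α := hα.isIntegral
  set P := minpoly ℚ α with hP
  have hP0 : P ≠ 0 := minpoly.ne_zero hint
  have hPα : aeval α P = 0 := minpoly.aeval ℚ α
  set g : ℚ⟮α⟯ := AdjoinSimple.gen ℚ α with hg
  have hgα : (g : ℝ) = α := AdjoinSimple.coe_gen ℚ α
  have hPg : aeval g P = 0 := by
    rw [hP, ← minpoly_gen]; exact minpoly.aeval ℚ g
  obtain ⟨Q, hQ⟩ : X - C g ∣ P.map (algebraMap ℚ ℚ⟮α⟯) := by
    rw [dvd_iff_isRoot, IsRoot.def, eval_map_algebraMap, hPg]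
  have hYL : ∀ (L : Type) [Field L] [CharZero L] [Algebra ℚ L],
      aeval (shift L L) (P.map (algebraMap ℚ L)) (fun k => (Y k : L)) = 0 := by
    intro L _ _ _
    have := aeval_shift_map (algebraMap ℚ L) (algebraMap ℚ L).toAddMonoidHom (by simp) P
      (fun k => (Y k : ℚ))
    rw [hY] at this
    simpa [funext_iff] using this
  -- Since P = (X − g)Q, the sequence Q(S)Y is killed by S − g, hence equals c·g^k.
  set c : ℚ⟮α⟯ := aeval (shift ℚ⟮α⟯ ℚ⟮α⟯) Q (fun k => (Y k : ℚ⟮α⟯)) 0 with hc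
  have hcK : ∀ k, aeval (shift ℚ⟮α⟯ ℚ⟮α⟯) Q (fun k => (Y k : ℚ⟮α⟯)) k = c * g ^ k := by
    apply eq_geom_of_aeval_shift_X_sub_C
    rw [← Module.End.mul_apply, ← map_mul, ← hQ]
    exact hYL _
  have hcL : ∀ (L : Type) [Field L] (ι : ℚ⟮α⟯ →+* L) (k : ℕ),
      aeval (shift L L) (Q.map ι) (fun k => (Y k : L)) k = ι c * ι g ^ k := by
    intro L _ ι k
    have := congrFun (aeval_shift_map ι ι.toAddMonoidHom (by simp) Q (fun k => (Y k : ℚ⟮α⟯))) k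
    simp only [hcK] at this
    simpa using this
  have hα0 : ¬ ‖α‖ < 1 := by rw [Real.norm_eq_abs]; exact not_lt.2 hα1.le
  -- the real place
  set ι : ℚ⟮α⟯ →+* ℝ := algebraMap ℚ⟮α⟯ ℝ with hι
  have hιg : ι g = α := hgα
  have hQα : (Q.map ι).eval α ≠ 0 := by
    have hsep : P.Separable := (minpoly.irreducible hint).separable
    have hd := hsep.aeval_derivative_ne_zero hPα
    have hPR : P.map (algebraMap ℚ ℝ) = (X - C α) * Q.map ι := by
      have := congrArg (Polynomial.map ι) hQ
      rw [Polynomial.map_map] at this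
      rw [hι, ← IsScalarTower.algebraMap_eq, ← hι, Polynomial.map_mul, Polynomial.map_sub, map_X,
        map_C, hιg] at this
      exact this
    rw [← eval_map_algebraMap, ← derivative_map, hPR] at hd
    simpa using hd
  -- Q(S)δ = (ξQ(α) − c)α^k tends to 0 while |α| > 1, so the coefficient vanishes.
  have hreal : ξ * (Q.map ι).eval α = ι c := by
    by_contra hne
    refine hα0 (norm_lt_one_of_tendsto_geom (sub_ne_zero.2 hne) ?_)
    have ht := aeval_shift_tendsto_zero (Q.map ι) hδ
    refine ht.congr fun k => ?_
    have : δ = (fun k => ξ * α ^ k) - fun k => (Y k : ℝ) := by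
      ext k; simp [h]
    rw [this, map_sub, aeval_shift_geom, Pi.sub_apply, hcL ℝ ι, hιg]
    ring
  have hc0 : c ≠ 0 := by
    intro h0
    rw [h0, map_zero] at hreal
    exact (mul_ne_zero hξ hQα) hreal
  refine ⟨?_, ?_, ?_⟩
  · have h1 : (Q.map ι).eval α = ι (Q.eval g) := by
      rw [← eval_map_apply, hιg]
    have h2 : ξ = ι (c / Q.eval g) := by
      rw [map_div₀, ← h1, ← hreal, mul_div_cancel_right₀ _ hQα]
    rw [h2]
    exact (c / Q.eval g).2
  · obtain ⟨R, hR, hR0⟩ := exists_monic_aeval_shift_eq_zero hP0 hY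
    refine ⟨R, hR, ?_⟩
    -- As R(S)Y = 0, R(S)δ = ξR(α)α^k, which tends to 0 only if R(α) = 0.
    by_contra hne
    refine hα0 (norm_lt_one_of_tendsto_geom (mul_ne_zero hξ hne) ?_)
    have ht := aeval_shift_tendsto_zero (R.map (algebraMap ℤ ℝ)) hδ
    refine ht.congr fun k => ?_
    have : δ = (fun k => ξ * α ^ k) - fun k => (Y k : ℝ) := by
      ext k; simp [h]
    have hY2 := aeval_shift_map (algebraMap ℤ ℝ) (algebraMap ℤ ℝ).toAddMonoidHom (by simp) R Y
    rw [hR0] at hY2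
    rw [this, map_sub, aeval_shift_geom, Pi.sub_apply]
    have hY3 := congrFun hY2 k
    simp only [RingHom.toAddMonoidHom_eq_coe, AddMonoidHom.coe_coe, algebraMap_int_eq, eq_intCast,
      Pi.zero_apply, Int.cast_zero] at hY3
    simp [hY3, eval_map]
  · intro z hz hzα
    let pb := adjoin.powerBasis hint
    have hpb : pb.gen = g := adjoin.powerBasis_gen hint
    let σ : ℚ⟮α⟯ →ₐ[ℚ] ℂ := pb.lift z (by rw [hpb, hg, minpoly_gen]; exact hz)
    have hσ : σ g = z := by rw [← hpb]; exact pb.lift_gen z _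
    have hPC : P.map (algebraMap ℚ ℂ) = (X - C z) * Q.map (σ : ℚ⟮α⟯ →+* ℂ) := by
      have := congrArg (Polynomial.map (σ : ℚ⟮α⟯ →+* ℂ)) hQ
      rw [Polynomial.map_map] at this
      simpa [hσ] using this
    have hQz : (Q.map (σ : ℚ⟮α⟯ →+* ℂ)).eval (α : ℂ) = 0 := by
      have h1 : (P.map (algebraMap ℚ ℂ)).eval (α : ℂ) = 0 := by
        rw [eval_map_algebraMap, show (α : ℂ) = algebraMap ℝ ℂ α from rfl, aeval_algebraMap_apply,
          hPα, map_zero]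
      rw [hPC, eval_mul] at h1
      refine (mul_eq_zero.1 h1).resolve_left ?_
      simpa [sub_eq_zero] using hzα.symm
    -- The conjugate of Q by σ vanishes at α, so applied to δ it leaves only −σ(c)z^k.
    refine norm_lt_one_of_tendsto_geom (c := -σ c) (by simpa using hc0) ?_
    have hδC : Tendsto (fun k => (δ k : ℂ)) atTop (nhds 0) := by
      rw [← Complex.ofReal_zero]
      exact (Complex.continuous_ofReal.tendsto 0).comp hδ
    have ht := aeval_shift_tendsto_zero (Q.map (σ : ℚ⟮α⟯ →+* ℂ)) hδC
    refine ht.congr fun k => ?_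
    have : (fun k => (δ k : ℂ)) = (fun k => (ξ : ℂ) * (α : ℂ) ^ k) - fun k => (Y k : ℂ) := by
      ext k
      have := congrArg (fun x : ℝ => (x : ℂ)) (h k)
      push_cast at this
      simp [this]
    rw [this, map_sub, aeval_shift_geom, Pi.sub_apply, hQz, hcL ℂ (σ : ℚ⟮α⟯ →+* ℂ)]
    simp [hσ]

/-! ### Geometric sequences with finitely many limit values. -/

/-- A real sequence with finitely many limit values modulo `1` is, modulo integers, a finitely
valued sequence plus an infinitesimal one. -/
lemma exists_decomposition_of_finite_limitValues {u : ℕ → ℝ}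
    (hu : (limitValues (fun k => (u k : UnitAddCircle))).Finite) :
    ∃ (n : ℕ → ℤ) (e δ : ℕ → ℝ), (Set.range e).Finite ∧ Tendsto δ atTop (nhds 0) ∧
      ∀ k, u k = n k + e k + δ k := by
  set E := limitValues (fun k => (u k : UnitAddCircle)) with hE
  have hne : E.Nonempty := by
    obtain ⟨x, -, hx⟩ := isCompact_univ.exists_mapClusterPt_of_frequently (l := atTop)
      (f := fun k => (u k : UnitAddCircle)) (Frequently.of_forall fun k => Set.mem_univ _)
    exact ⟨x, hx⟩
  -- `x k` is a point of `E` nearest to the `k`-th term; its real lift will be `e k`.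
  choose x hxE hx using fun k => hu.isCompact.exists_infDist_eq_dist hne (u k : UnitAddCircle)
  have hdist : Tendsto (fun k => dist (u k : UnitAddCircle) (x k)) atTop (nhds 0) := by
    rw [Metric.tendsto_atTop']
    intro ε hε
    have hev := eventually_mem_of_limitValues_subset (Metric.isOpen_thickening (δ := ε) (E := E))
      (Metric.self_subset_thickening hε E)
    obtain ⟨N, hN⟩ := eventually_atTop.1 hev
    refine ⟨N, fun k hk => ?_⟩
    rw [Real.dist_eq, sub_zero, abs_of_nonneg dist_nonneg, ← hx k]
    exact Metric.mem_thickening_iff_infDist_lt hne |>.1 (hN k hk.le)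
  let r : UnitAddCircle → ℝ := Function.surjInv QuotientAddGroup.mk_surjective
  have hr : ∀ y, ((r y : ℝ) : UnitAddCircle) = y := Function.surjInv_eq _
  refine ⟨fun k => round (u k - r (x k)), fun k => r (x k),
    fun k => u k - r (x k) - round (u k - r (x k)), ?_, ?_, fun k => by ring⟩
  · refine (hu.image r).subset ?_
    rintro _ ⟨k, rfl⟩
    exact ⟨x k, hxE k, rfl⟩
  · refine (tendsto_zero_iff_abs_tendsto_zero _).2 (hdist.congr fun k => ?_)
    rw [Function.comp_apply, ← UnitAddCircle.norm_eq, dist_eq_norm, AddCircle.coe_sub, hr]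

/-- Modulo 1, `s` takes finitely many values and tends to 0, so it is eventually an integer, of
absolute value below 1. -/
lemma eventually_eq_zero_of_finite_mod_int {t s : ℕ → ℝ} {n : ℕ → ℤ} (ht : (Set.range t).Finite)
    (hs : Tendsto s atTop (nhds 0)) (h : ∀ k, s k = n k + t k) : ∀ᶠ k in atTop, s k = 0 := by
  have hst : ∀ k, (s k : UnitAddCircle) = (t k : UnitAddCircle) := fun k => by
    rw [h k]; simp
  set T : Set UnitAddCircle := (fun x : ℝ => (x : UnitAddCircle)) '' Set.range t \ {0} with hT
  have hTf : T.Finite := (ht.image _).subset Set.sdiff_subset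
  have hs' : Tendsto (fun k => (s k : UnitAddCircle)) atTop (nhds 0) :=
    ((AddCircle.continuous_mk' (1 : ℝ)).tendsto 0).comp hs
  have h1 : ∀ᶠ k in atTop, (s k : UnitAddCircle) ∈ Tᶜ :=
    hs' (hTf.isClosed.isOpen_compl.mem_nhds (by simp [hT]))
  have h2 : ∀ᶠ k in atTop, |s k| < 1 := by
    have := hs.abs
    rw [abs_zero] at this
    exact this (gt_mem_nhds one_pos)
  filter_upwards [h1, h2] with k hk1 hk2
  have hk0 : (s k : UnitAddCircle) = 0 := by
    by_contra hne
    exact hk1 ⟨⟨t k, ⟨k, rfl⟩, (hst k).symm⟩, hne⟩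
  obtain ⟨m, hm⟩ := (AddCircle.coe_eq_zero_iff (1 : ℝ)).1 hk0
  simp only [zsmul_eq_mul, mul_one] at hm
  rw [← hm] at hk2 ⊢
  have : |m| < 1 := by exact_mod_cast hk2
  rw [Int.abs_lt_one_iff.1 this, Int.cast_zero]

/-- A finitely valued sequence killed by a polynomial in the shift which is coprime to all
`X ^ k * (X ^ q - 1)` is zero. -/
lemma eq_zero_of_finite_range {K A : Type*} [Field K] [AddCommGroup A] [Module K A] {P : K[X]}
    (hP0 : P ≠ 0) (hP : ∀ k q : ℕ, q ≠ 0 → IsCoprime P (X ^ k * (X ^ q - 1))) {w : ℕ → A}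
    (hfin : (Set.range w).Finite) (hw : aeval (shift K A) P w = 0) : w = 0 := by
  have : Finite (Set.range w) := hfin
  -- Pigeonhole on windows of length `P.natDegree`: two equal windows force eventual periodicity,
  -- since `P` propagates the equality.
  obtain ⟨a, b, hab, heq⟩ := Finite.exists_ne_map_eq_of_infinite
    (fun k : ℕ => fun i : Fin P.natDegree => (⟨w (k + i), k + i, rfl⟩ : Set.range w))
  wlog hlt : a < b generalizing a b
  · exact this b a hab.symm heq.symm (lt_of_le_of_ne (not_lt.1 hlt) hab.symm)
  obtain ⟨q, hq⟩ := Nat.exists_eq_add_of_lt hlt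
  have hz : aeval (shift K A) (X ^ a * (X ^ (q + 1) - 1) : K[X]) w = 0 := by
    refine eq_zero_of_aeval_shift_eq_zero hP0 ?_ fun i hi => ?_
    · rw [← Module.End.mul_apply, ← map_mul, mul_comm, map_mul, Module.End.mul_apply, hw, map_zero]
    · have := congrArg Subtype.val (congrFun heq ⟨i, hi⟩)
      simp only at this
      simp only [map_mul, map_sub, map_pow, aeval_X, map_one, Module.End.mul_apply,
        shift_pow_apply, LinearMap.sub_apply, Module.End.one_apply, Pi.sub_apply]
      rw [add_comm i a, this, hq, sub_eq_zero]
      congr 1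
      ring
  obtain ⟨s, t, hst⟩ := hP a (q + 1) q.succ_ne_zero
  have := congrArg (fun p => aeval (shift K A) p w) hst
  simpa only [map_add, map_mul _ s, map_mul _ t, Module.End.mul_apply, LinearMap.add_apply, hw, hz,
    map_zero, add_zero, map_one, Module.End.one_apply, eq_comm] using this

lemma isCoprime_minpoly_X_pow {α : ℝ} (hα : IsAlgebraic ℚ α) (hα1 : 1 < |α|) (k q : ℕ)
    (hq : q ≠ 0) : IsCoprime (minpoly ℚ α) (X ^ k * (X ^ q - 1)) := by
  rw [(minpoly.irreducible hα.isIntegral).coprime_iff_not_dvd]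
  rintro ⟨r, hr⟩
  have h := congrArg (aeval α) hr
  simp only [map_mul, minpoly.aeval, zero_mul, map_sub, map_pow, aeval_X, map_one, mul_eq_zero,
    sub_eq_zero] at h
  rcases h with h | h
  · rw [eq_zero_of_pow_eq_zero h, abs_zero] at hα1
    linarith
  · have h1 := one_lt_pow₀ hα1 hq
    rw [← abs_pow, h, abs_one] at h1
    exact lt_irrefl _ h1

lemma exists_int_polynomial_map_eq (P : ℚ[X]) :
    ∃ (p : ℤ[X]) (b : ℤ), b ≠ 0 ∧ p.map (Int.castRingHom ℚ) = b • P ∧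
      p.map (Int.castRingHom ℝ) = (b • P).map (algebraMap ℚ ℝ) := by
  obtain ⟨b, hb, h⟩ := IsLocalization.integerNormalization_spec (nonZeroDivisors ℤ) P
  refine ⟨_, b, nonZeroDivisors.ne_zero hb, h, ?_⟩
  rw [← h, Polynomial.map_map]
  congr 1

lemma exists_common_denominator {ι : Type*} {r : ι → ℚ} (hr : (Set.range r).Finite) :
    ∃ D : ℕ, D ≠ 0 ∧ ∀ i, ∃ m : ℤ, (m : ℚ) = D * r i := by
  refine ⟨∏ x ∈ hr.toFinset, x.den, Finset.prod_ne_zero_iff.2 fun x _ => x.den_nz, fun i => ?_⟩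
  obtain ⟨c, hc⟩ := Finset.dvd_prod_of_mem (fun x : ℚ => x.den)
    (hr.mem_toFinset.2 (Set.mem_range_self i))
  refine ⟨c * (r i).num, ?_⟩
  rw [hc]
  push_cast
  rw [mul_comm ((r i).den : ℚ), mul_assoc, Rat.den_mul_eq_num]

open IntermediateField in
/-- If `ξ α ^ k` has finitely many limit values modulo `1`, then `ξ ∈ ℚ(α)` and `α` is an algebraic
integer whose other conjugates lie in the open unit disc. -/
theorem pisot_of_finite_limitValues_geom {α ξ : ℝ} (hα : IsAlgebraic ℚ α) (hα1 : 1 < |α|)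
    (hξ : ξ ≠ 0) (h : (limitValues (fun k : ℕ => ((ξ * α ^ k : ℝ) : UnitAddCircle))).Finite) :
    ξ ∈ ℚ⟮α⟯ ∧ IsIntegral ℤ α ∧
      ∀ z : ℂ, aeval z (minpoly ℚ α) = 0 → z ≠ (α : ℂ) → ‖z‖ < 1 := by
  have hα0 : α ≠ 0 := fun h0 => by rw [h0, abs_zero] at hα1; linarith
  obtain ⟨n, e, δ, he, hδ, hu⟩ := exists_decomposition_of_finite_limitValues h
  obtain ⟨p, b, hb, -, hpR⟩ := exists_int_polynomial_map_eq (minpoly ℚ α)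
  set pR := p.map (Int.castRingHom ℝ) with hpRdef
  set y : ℕ → ℝ := fun k => n k + e k with hy
  have hyδ : y = (fun k => ξ * α ^ k) - δ := by
    ext k; simp [hy, hu]
  have hs : Tendsto (aeval (shift ℝ ℝ) pR y) atTop (nhds 0) := by
    have h0 : pR.eval α = 0 := by
      rw [hpR, eval_map_algebraMap, map_zsmul, minpoly.aeval, smul_zero]
    have h1 : aeval (shift ℝ ℝ) pR y = -aeval (shift ℝ ℝ) pR δ := by
      rw [hyδ, map_sub, aeval_shift_geom, h0]
      ext k; simp
    rw [h1, ← neg_zero]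
    exact (aeval_shift_tendsto_zero pR hδ).neg
  have hs0 : ∀ᶠ k in atTop, aeval (shift ℝ ℝ) pR y k = 0 := by
    have het : (Set.range (aeval (shift ℝ ℝ) pR e)).Finite := by
      refine aeval_shift_induction (Q := fun u => (Set.range u).Finite) ?_ ?_ ?_ pR he
      · intro u v hu hv
        refine (hu.add hv).subset ?_
        rintro _ ⟨k, rfl⟩
        exact Set.add_mem_add ⟨k, rfl⟩ ⟨k, rfl⟩
      · intro c u hu
        refine (hu.image (c • ·)).subset ?_
        rintro _ ⟨k, rfl⟩
        exact ⟨u k, ⟨k, rfl⟩, rfl⟩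
      · intro u hu
        refine hu.subset ?_
        rintro _ ⟨k, rfl⟩
        exact ⟨k + 1, rfl⟩
    refine eventually_eq_zero_of_finite_mod_int (n := aeval (shift ℤ ℤ) p n) het hs fun k => ?_
    have h1 := congrFun (aeval_shift_map (Int.castRingHom ℝ) (Int.castAddHom ℝ) (by simp) p n) k
    have h2 : y = (fun k => (n k : ℝ)) + e := rfl
    rw [h2, map_add, Pi.add_apply]
    exact congrArg (· + _) h1
  obtain ⟨K, hK⟩ := eventually_atTop.1 hs0
  have hyP : aeval (shift ℚ ℝ) (minpoly ℚ α) (fun k => y (K + k)) = 0 := by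
    have h1 : aeval (shift ℝ ℝ) pR (fun k => y (K + k)) = 0 := by
      rw [aeval_shift_comp_add]
      ext k
      exact hK _ (Nat.le_add_right K k)
    have h2 := aeval_shift_map (algebraMap ℚ ℝ) (AddMonoidHom.id ℝ)
      (fun r a => by simp [Algebra.smul_def]) (b • minpoly ℚ α) (fun k => y (K + k))
    simp only [AddMonoidHom.id_apply] at h2
    rw [← hpR, h1, map_zsmul] at h2
    ext k
    have h3 := congrFun h2 k
    simpa [hb] using h3.symm
  -- A ℚ-linear retraction ψ of ℝ onto ℚ. The map x − ψ(x) kills integers, so on `y` it is finitely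
  -- valued and still obeys the recurrence, hence zero: `y` is rational from `K` on.
  obtain ⟨ψ, hψ⟩ := LinearMap.exists_leftInverse_of_injective (Algebra.linearMap ℚ ℝ)
    (LinearMap.ker_eq_bot.2 (algebraMap ℚ ℝ).injective)
  have hψ' : ∀ r : ℚ, ψ (r : ℝ) = r := fun r => LinearMap.congr_fun hψ r
  have hψn : ∀ m : ℤ, ψ (m : ℝ) = m := fun m => by simpa using hψ' m
  let f : ℝ →ₗ[ℚ] ℝ := LinearMap.id - Algebra.linearMap ℚ ℝ ∘ₗ ψ
  have hf : ∀ x, f x = x - (ψ x : ℝ) := fun x => rfl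
  have hw : (fun k => f (y (K + k))) = 0 := by
    refine eq_zero_of_finite_range (K := ℚ) (minpoly.ne_zero hα.isIntegral)
      (isCoprime_minpoly_X_pow hα hα1) ?_ ?_
    · refine (he.image f).subset ?_
      rintro _ ⟨k, rfl⟩
      exact ⟨e (K + k), ⟨K + k, rfl⟩, by simp [hf, hy, hψn]⟩
    · have h1 := aeval_shift_map (RingHom.id ℚ) f.toAddMonoidHom (by simp) (minpoly ℚ α)
        (fun k => y (K + k))
      rw [hyP, Polynomial.map_id] at h1
      simpa [funext_iff] using h1
  have hyψ : ∀ k, y (K + k) = (ψ (y (K + k)) : ℝ) := fun k => by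
    have := congrFun hw k
    simpa [hf, sub_eq_zero] using this
  obtain ⟨D, hD, hDm⟩ := exists_common_denominator (r := fun k => ψ (e k)) (by
    refine (he.image ψ).subset ?_
    rintro _ ⟨k, rfl⟩
    exact ⟨e k, ⟨k, rfl⟩, rfl⟩)
  choose m hm using hDm
  have hYψ : ∀ k, ((D * n (K + k) + m (K + k) : ℤ) : ℚ) = D * ψ (y (K + k)) := fun k => by
    simp [hy, hψn, hm, mul_add]
  have hYP : aeval (shift ℚ ℚ) (minpoly ℚ α)
      (fun k => ((D * n (K + k) + m (K + k) : ℤ) : ℚ)) = 0 := by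
    have h1 := aeval_shift_map (RingHom.id ℚ) ((D : ℚ) • ψ).toAddMonoidHom (by simp)
      (minpoly ℚ α) (fun k => y (K + k))
    rw [hyP, Polynomial.map_id] at h1
    simp only [hYψ]
    simpa [funext_iff] using h1
  have hDR : (D : ℝ) ≠ 0 := by exact_mod_cast hD
  obtain ⟨h1, h2, h3⟩ := pisot_of_integer_recurrence (ξ := D * ξ * α ^ K) hα hα1
    (mul_ne_zero (mul_ne_zero hDR hξ) (pow_ne_zero _ hα0))
    (Y := fun k => D * n (K + k) + m (K + k)) (δ := fun k => D * δ (K + k))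
    (by
      have := (hδ.comp (tendsto_add_atTop_nat K)).const_mul (D : ℝ)
      simpa [Function.comp_def, add_comm] using this)
    (fun k => by
      have e1 := hu (K + k)
      have e2 := hyψ k
      have e3 : (((D * n (K + k) + m (K + k) : ℤ) : ℚ) : ℝ) = ((D * ψ (y (K + k)) : ℚ) : ℝ) := by
        rw [hYψ]
      rw [Rat.cast_intCast, Rat.cast_mul, ← e2, Rat.cast_natCast] at e3
      rw [e3, hy]
      simp only
      rw [← mul_add, ← e1, pow_add]
      ring) hYP
  refine ⟨?_, h2, h3⟩
  have hαK : α ∈ ℚ⟮α⟯ := mem_adjoin_simple_self ℚ α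
  have : ξ = (D * ξ * α ^ K) / ((D : ℝ) * α ^ K) := by
    field_simp
  rw [this]
  exact div_mem h1 (mul_mem (_root_.natCast_mem _ D) (pow_mem hαK K))

/-! ### Small conjugates imply finitely many limit values. -/

/-- A real algebraic integer all of whose conjugates other than itself have modulus less than `1`.
When `1 < |α|` this says that `|α|` is a Pisot number. -/
def HasSmallConjugates (α : ℝ) : Prop :=
  IsIntegral ℤ α ∧ ∀ z : ℂ, aeval z (minpoly ℚ α) = 0 → z ≠ (α : ℂ) → ‖z‖ < 1

lemma HasSmallConjugates.neg {α : ℝ} (h : HasSmallConjugates α) : HasSmallConjugates (-α) := by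
  refine ⟨h.1.neg, fun z hz hzα => ?_⟩
  rw [← norm_neg]
  refine h.2 (-z) ?_ fun h0 => hzα (by rw [← neg_neg z, h0]; simp)
  obtain ⟨r, hr⟩ : minpoly ℚ (-α) ∣ (minpoly ℚ α).comp (-X) :=
    minpoly.dvd ℚ (-α) (by simp [aeval_comp])
  have := congrArg (aeval z) hr
  simpa [aeval_comp, hz] using this

lemma isPisot_abs_iff {α : ℝ} (hα1 : 1 < |α|) : IsPisot |α| ↔ HasSmallConjugates α := by
  have key : IsPisot |α| ↔ HasSmallConjugates |α| := and_iff_right hα1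
  rw [key]
  rcases abs_choice α with h | h <;> rw [h]
  exact ⟨fun h => by simpa using h.neg, fun h => h.neg⟩

open IntermediateField in
/-- The powers of a Pisot number are exponentially close to the traces of these powers. -/
lemma HasSmallConjugates.exists_int_approx {α : ℝ} (h : HasSmallConjugates α) :
    ∃ t : ℕ → ℤ, ∀ n i : ℕ,
      Tendsto (fun k : ℕ => (k : ℝ) ^ n * (α ^ (k + i) - t (k + i))) atTop (nhds 0) := by
  have hint : IsIntegral ℚ α := h.1.tower_top
  have : FiniteDimensional ℚ ℚ⟮α⟯ := adjoin.finiteDimensional hint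
  set g : ℚ⟮α⟯ := AdjoinSimple.gen ℚ α with hg
  have hgα : (g : ℝ) = α := AdjoinSimple.coe_gen ℚ α
  have hgint : IsIntegral ℤ g := by
    rw [← isIntegral_algebraMap_iff (algebraMap ℚ⟮α⟯ ℝ).injective]
    exact (congrArg (IsIntegral ℤ) hgα).mpr h.1
  have ht : ∀ k : ℕ, ∃ t : ℤ, (t : ℚ) = Algebra.trace ℚ ℚ⟮α⟯ (g ^ k) := fun k =>
    IsIntegrallyClosed.isIntegral_iff.1 (Algebra.isIntegral_trace (hgint.pow k))
  choose t ht using ht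
  refine ⟨t, fun n i => ?_⟩
  let ι : ℚ⟮α⟯ →ₐ[ℚ] ℂ := (Complex.ofRealAm.restrictScalars ℚ).comp (val ℚ⟮α⟯)
  have hι : ι g = α := congrArg Complex.ofReal hgα
  have hσ : ∀ σ : ℚ⟮α⟯ →ₐ[ℚ] ℂ, σ ≠ ι → ‖σ g‖ < 1 := by
    intro σ hne
    refine h.2 _ ?_ fun h0 => hne ?_
    · have hg0 : aeval g (minpoly ℚ α) = 0 := by
        rw [← minpoly_gen]; exact minpoly.aeval ℚ g
      rw [aeval_algHom_apply, hg0, map_zero]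
    · have e : (adjoin.powerBasis hint).gen = g := adjoin.powerBasis_gen hint
      refine (adjoin.powerBasis hint).algHom_ext ?_
      exact (congrArg σ e).trans (h0.trans (hι.symm.trans (congrArg ι e.symm)))
  classical
  -- The trace is the sum over all embeddings; removing the inclusion `ι` leaves only powers of
  -- numbers of modulus below 1.
  have hsum : ∀ k : ℕ, ((α ^ k - t k : ℝ) : ℂ) = -∑ σ ∈ Finset.univ.erase ι, σ g ^ k := by
    intro k
    have h1 := trace_eq_sum_embeddings ℂ (K := ℚ) (x := g ^ k)
    rw [← ht, ← Finset.add_sum_erase _ _ (Finset.mem_univ ι)] at h1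
    simp only [map_pow, hι] at h1
    have h2 : ((t k : ℤ) : ℂ) = (α : ℂ) ^ k + ∑ σ ∈ Finset.univ.erase ι, σ g ^ k := by
      simpa using h1
    push_cast
    rw [h2]
    ring
  have hlim : Tendsto (fun k : ℕ => -∑ σ ∈ Finset.univ.erase ι,
      σ g ^ i * ((k : ℂ) ^ n * σ g ^ k)) atTop (nhds 0) := by
    have : Tendsto (fun k : ℕ => -∑ σ ∈ Finset.univ.erase ι,
        σ g ^ i * ((k : ℂ) ^ n * σ g ^ k)) atTop
        (nhds (-∑ σ ∈ Finset.univ.erase ι, σ g ^ i * 0)) := by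
      refine (tendsto_finsetSum _ fun σ hmem => Tendsto.const_mul _ ?_).neg
      rw [tendsto_zero_iff_norm_tendsto_zero]
      have := tendsto_pow_const_mul_const_pow_of_lt_one n (norm_nonneg _)
        (hσ σ (Finset.ne_of_mem_erase hmem))
      simpa using this
    simpa using this
  have := (Complex.continuous_re.tendsto 0).comp hlim
  rw [Complex.zero_re] at this
  refine this.congr fun k => ?_
  have : -∑ σ ∈ Finset.univ.erase ι, σ g ^ i * ((k : ℂ) ^ n * σ g ^ k) =
      (((k : ℝ) ^ n * (α ^ (k + i) - t (k + i)) : ℝ) : ℂ) := by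
    rw [Complex.ofReal_mul, hsum, mul_neg, Finset.mul_sum]
    push_cast
    congr 1
    exact Finset.sum_congr rfl fun σ _ => by ring
  rw [Function.comp_apply, this, Complex.ofReal_re]

lemma finite_limitValues_of_zsmul {b : ℤ} (hb : b ≠ 0) {u : ℕ → UnitAddCircle}
    (hu : (limitValues (b • u)).Finite) : (limitValues u).Finite := by
  refine finite_limitValues_of_nsmul (Int.natAbs_ne_zero.2 hb) ?_
  have : (fun k => b.natAbs • u k) = (b.sign : ℤ) • (b • u) := by
    ext k
    rw [Pi.smul_apply, Pi.smul_apply, smul_smul, Int.sign_mul_self_eq_natAbs, natCast_zsmul]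
  rw [this]
  exact finite_limitValues_zsmul _ hu

lemma finite_limitValues_eval_mul {s : Set ℝ} {w : ℕ → ℝ}
    (h : ∀ c ∈ s, ∀ n : ℕ,
      (limitValues (fun k : ℕ => ((c * (k : ℝ) ^ n * w k : ℝ) : UnitAddCircle))).Finite)
    {F : ℝ[X]} (hF : ∀ n, F.coeff n ∈ s) :
    (limitValues (fun k : ℕ => ((F.eval (k : ℝ) * w k : ℝ) : UnitAddCircle))).Finite := by
  have key : ∀ N : ℕ, (limitValues (fun k : ℕ => (((∑ n ∈ Finset.range N,
      F.coeff n * (k : ℝ) ^ n) * w k : ℝ) : UnitAddCircle))).Finite := by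
    intro N
    induction N with
    | zero =>
      refine (Set.finite_singleton (0 : UnitAddCircle)).subset (limitValues_subset_of_tendsto ?_)
      simp
    | succ N ih =>
      refine (finite_limitValues_add ih (h _ (hF N) N)).subset (Eq.subset ?_)
      congr 1
      ext k
      rw [Finset.sum_range_succ, add_mul, AddCircle.coe_add]
      rfl
  simpa only [← eval_eq_sum_range] using key (F.natDegree + 1)

lemma finite_limitValues_rat_mul_pow (c : ℚ) (n : ℕ) :
    (limitValues (fun k : ℕ => (((c : ℝ) * (k : ℝ) ^ n * 1 : ℝ) : UnitAddCircle))).Finite := by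
  refine finite_limitValues_of_zsmul (b := c.den) (by exact_mod_cast c.den_nz) ?_
  refine (Set.finite_singleton (0 : UnitAddCircle)).subset (limitValues_subset_of_tendsto ?_)
  refine tendsto_const_nhds.congr fun k => ?_
  rw [Pi.smul_apply, ← AddCircle.coe_zsmul, eq_comm, AddCircle.coe_eq_zero_iff]
  refine ⟨c.num * (k : ℤ) ^ n, ?_⟩
  have : (c.den : ℝ) * c = c.num := by exact_mod_cast Rat.den_mul_eq_num c
  simp only [zsmul_eq_mul, mul_one]
  push_cast
  rw [← mul_assoc, this]

-- After clearing denominators, `c` is an integer polynomial in α, and each k^n α^(k+i) is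
-- o(1)-close to the integer k^n t(k+i).
open IntermediateField in
lemma HasSmallConjugates.finite_limitValues_mul_pow {α : ℝ} (h : HasSmallConjugates α) {c : ℝ}
    (hc : c ∈ ℚ⟮α⟯) (n : ℕ) :
    (limitValues (fun k : ℕ => ((c * (k : ℝ) ^ n * α ^ k : ℝ) : UnitAddCircle))).Finite := by
  obtain ⟨t, ht⟩ := h.exists_int_approx
  have hint : IsIntegral ℚ α := h.1.tower_top
  obtain ⟨q, rfl⟩ : ∃ q : ℚ[X], aeval α q = c := by
    rw [← mem_toSubalgebra, adjoin_simple_toSubalgebra_of_isAlgebraic hint.isAlgebraic,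
      Algebra.adjoin_singleton_eq_range_aeval] at hc
    exact hc
  obtain ⟨p, b, hb, hp, -⟩ := exists_int_polynomial_map_eq q
  refine finite_limitValues_of_zsmul hb ?_
  have hpq : aeval α p = b • aeval α q := by
    rw [← map_zsmul, ← hp, ← algebraMap_int_eq, aeval_map_algebraMap]
  have key : ∀ p : ℤ[X], (limitValues
      (fun k : ℕ => ((aeval α p * (k : ℝ) ^ n * α ^ k : ℝ) : UnitAddCircle))).Finite := by
    intro p
    induction p using Polynomial.induction_on' with
    | add p q hp hq =>
      refine (finite_limitValues_add hp hq).subset (Eq.subset ?_)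
      congr 1
      ext k
      rw [Pi.add_apply, ← AddCircle.coe_add, map_add]
      congr 1
      ring
    | monomial i a =>
      have h0 : (limitValues
          (fun k : ℕ => (((k : ℝ) ^ n * α ^ (k + i) : ℝ) : UnitAddCircle))).Finite := by
        refine (Set.finite_singleton (0 : UnitAddCircle)).subset (limitValues_subset_of_tendsto ?_)
        refine (((AddCircle.continuous_mk' (1 : ℝ)).tendsto 0).comp (ht n i)).congr fun k => ?_
        change (((k : ℝ) ^ n * (α ^ (k + i) - t (k + i)) : ℝ) : UnitAddCircle) = _
        rw [mul_sub, AddCircle.coe_sub, sub_eq_self, AddCircle.coe_eq_zero_iff]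
        exact ⟨(k : ℤ) ^ n * t (k + i), by simp⟩
      refine (finite_limitValues_zsmul a h0).subset (Eq.subset ?_)
      congr 1
      ext k
      rw [Pi.smul_apply, ← AddCircle.coe_zsmul, aeval_monomial]
      congr 1
      simp only [algebraMap_int_eq, eq_intCast, zsmul_eq_mul]
      ring
  refine (key p).subset (Eq.subset ?_)
  congr 1
  ext k
  rw [Pi.smul_apply, ← AddCircle.coe_zsmul, hpq]
  congr 1
  simp only [zsmul_eq_mul]
  ring

/-! ### Polynomial coefficients: reduction and descent. -/

open fwdDiff in
lemma aeval_shift_X_sub_C_pow (z : ℝ) (m : ℕ) (f : ℝ → ℝ) :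
    aeval (shift ℝ ℝ) ((X - C z) ^ m) (fun k : ℕ => f k * z ^ k) =
      fun k : ℕ => z ^ m * ((Δ_[1])^[m] f) k * z ^ k := by
  induction m generalizing f with
  | zero => simp
  | succ m ih =>
    have h1 : aeval (shift ℝ ℝ) (X - C z) (fun k : ℕ => f k * z ^ k) =
        z • fun k : ℕ => (Δ_[1] f) k * z ^ k := by
      ext k
      simp [Module.algebraMap_end_apply, fwdDiff]
      ring
    rw [pow_succ, map_mul, Module.End.mul_apply, h1, map_smul, ih]
    ext k
    rw [Pi.smul_apply, Function.iterate_succ_apply, smul_eq_mul]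
    ring

/-- Descent on the degree. -/
lemma coeff_mem_of_leadingCoeff_mem {s : Set ℝ} {Q : ℝ[X] → Prop} (h0 : (0 : ℝ) ∈ s)
    (hlead : ∀ F, F ≠ 0 → Q F → F.leadingCoeff ∈ s)
    (herase : ∀ F, F.leadingCoeff ∈ s → Q F → Q F.eraseLead) {F : ℝ[X]} (hF : Q F) (n : ℕ) :
    F.coeff n ∈ s := by
  induction hc : F.support.card using Nat.strong_induction_on generalizing F with
  | _ c ih =>
    by_cases hF0 : F = 0
    · simpa [hF0] using h0
    · have hl := hlead F hF0 hF
      have := ih _ (hc ▸ eraseLead_support_card_lt hF0) (herase F hl hF) rfl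
      rw [eraseLead_coeff] at this
      split_ifs at this with hn
      · rwa [hn]
      · exact this

open fwdDiff in
lemma fwdDiff_iter_eval_natDegree (F : ℝ[X]) (x : ℝ) :
    ((Δ_[1])^[F.natDegree] F.eval) x = F.leadingCoeff * (F.natDegree.factorial : ℝ) := by
  rw [F.fwdDiff_iter_degree_eq_factorial]
  simp

-- With p = (X − α)Q an integer multiple of the minimal polynomial and n = deg F, (S − α)^n turns
-- F(k) into a constant by n-fold differencing and Q(S)^n multiplies by Q(α)^n. The total factor `κ`
-- is a nonzero element of ℚ(α), so the geometric case applies.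
open IntermediateField fwdDiff in
lemma leadingCoeff_mem_adjoin {α : ℝ} (hα : IsAlgebraic ℚ α) (hα1 : 1 < |α|) {F : ℝ[X]}
    (hF : F ≠ 0)
    (h : (limitValues (fun k : ℕ => ((F.eval (k : ℝ) * α ^ k : ℝ) : UnitAddCircle))).Finite) :
    F.leadingCoeff ∈ ℚ⟮α⟯ ∧ HasSmallConjugates α := by
  have hα0 : α ≠ 0 := fun h0 => by rw [h0, abs_zero] at hα1; linarith
  have hint : IsIntegral ℚ α := hα.isIntegral
  obtain ⟨p, b, hb, -, hpR⟩ := exists_int_polynomial_map_eq (minpoly ℚ α)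
  set pR := p.map (Int.castRingHom ℝ) with hpRdef
  obtain ⟨Q, hQ⟩ : X - C α ∣ pR := by
    rw [dvd_iff_isRoot, IsRoot.def, hpR, eval_map_algebraMap, map_zsmul, minpoly.aeval, smul_zero]
  -- Q(α) = p′(α), nonzero by separability.
  have hQd : Q.eval α = b • aeval α (derivative (minpoly ℚ α)) := by
    have h1 : (derivative pR).eval α = Q.eval α := by rw [hQ]; simp
    rw [← h1, hpR, derivative_map, eval_map_algebraMap, ← map_zsmul, derivative_smul]
  have hQ0 : Q.eval α ≠ 0 := by
    rw [hQd]
    exact smul_ne_zero hb ((minpoly.irreducible hint).separable.aeval_derivative_ne_zero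
      (minpoly.aeval ℚ α))
  have hαK : α ∈ ℚ⟮α⟯ := mem_adjoin_simple_self ℚ α
  have hQK : Q.eval α ∈ ℚ⟮α⟯ := by
    rw [hQd]
    refine zsmul_mem ?_ b
    have := aeval_algebraMap_apply ℝ (AdjoinSimple.gen ℚ α) (derivative (minpoly ℚ α))
    rw [AdjoinSimple.algebraMap_gen] at this
    rw [this]
    exact SetLike.coe_mem _
  set n := F.natDegree with hn
  set κ : ℝ := α ^ n * (n.factorial : ℝ) * Q.eval α ^ n with hκ
  have hκ0 : κ ≠ 0 := mul_ne_zero (mul_ne_zero (pow_ne_zero _ hα0)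
    (by exact_mod_cast n.factorial_ne_zero)) (pow_ne_zero _ hQ0)
  have hκK : κ ∈ ℚ⟮α⟯ := mul_mem (mul_mem (pow_mem hαK n) (_root_.natCast_mem _ _)) (pow_mem hQK n)
  have hfin := finite_limitValues_aeval_shift (p ^ n) h
  have hgeom : aeval (shift ℝ ℝ) (pR ^ n) (fun k : ℕ => F.eval (k : ℝ) * α ^ k) =
      fun k => F.leadingCoeff * κ * α ^ k := by
    rw [hQ, mul_pow, mul_comm, map_mul, Module.End.mul_apply, aeval_shift_X_sub_C_pow α n F.eval]
    simp only [hn, fwdDiff_iter_eval_natDegree]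
    rw [aeval_shift_geom]
    ext k
    rw [hκ, eval_pow]
    ring
  rw [aeval_shift_coe_circle, Polynomial.map_pow, ← hpRdef, hgeom] at hfin
  obtain ⟨h1, h2⟩ := pisot_of_finite_limitValues_geom hα hα1
    (mul_ne_zero (leadingCoeff_ne_zero.2 hF) hκ0) hfin
  refine ⟨?_, h2⟩
  rw [← mul_div_cancel_right₀ F.leadingCoeff hκ0]
  exact div_mem h1 hκK

/-- The descent step: dropping an already controlled leading term perturbs the sequence by one with
finitely many limit values. The summand `u` is carried along unchanged. -/
lemma finite_limitValues_eraseLead {w : ℕ → ℝ} {G : ℝ[X]}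
    (h : (limitValues (fun k : ℕ =>
      ((G.leadingCoeff * (k : ℝ) ^ G.natDegree * w k : ℝ) : UnitAddCircle))).Finite)
    {u : ℕ → ℝ} : ∃ v : ℕ → UnitAddCircle, (limitValues v).Finite ∧
      (fun k : ℕ => ((u k + G.eraseLead.eval (k : ℝ) * w k : ℝ) : UnitAddCircle)) =
      (fun k : ℕ => ((u k + G.eval (k : ℝ) * w k : ℝ) : UnitAddCircle)) + v := by
  refine ⟨_, finite_limitValues_neg h, ?_⟩
  ext k
  rw [Pi.add_apply, Pi.neg_apply, ← AddCircle.coe_neg, ← AddCircle.coe_add,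
    ← self_sub_monomial_natDegree_leadingCoeff]
  congr 1
  simp only [eval_sub, eval_monomial]
  ring

open IntermediateField in
theorem coeff_mem_adjoin_of_finite {α : ℝ} (hα : IsAlgebraic ℚ α) (hα1 : 1 < |α|) {F : ℝ[X]}
    (h : (limitValues (fun k : ℕ => ((F.eval (k : ℝ) * α ^ k : ℝ) : UnitAddCircle))).Finite)
    (hP : HasSmallConjugates α) (n : ℕ) : F.coeff n ∈ ℚ⟮α⟯ := by
  refine coeff_mem_of_leadingCoeff_mem (s := ℚ⟮α⟯)
    (Q := fun F => (limitValues
      (fun k : ℕ => ((F.eval (k : ℝ) * α ^ k : ℝ) : UnitAddCircle))).Finite)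
    (zero_mem _) (fun F hF h => (leadingCoeff_mem_adjoin hα hα1 hF h).1) (fun F hl h => ?_) h n
  obtain ⟨v, hv, hveq⟩ := finite_limitValues_eraseLead (u := 0)
    (hP.finite_limitValues_mul_pow hl F.natDegree)
  simp only [Pi.zero_apply, zero_add] at hveq
  rw [hveq]
  exact finite_limitValues_add h hv

-- With n = deg G and m = deg F + 1, (S − 1)^n p(S)^m kills the exponential part and sends G to an
-- irrational constant `a`. With one factor S − 1 fewer, the circle sequence is a rotation by `a`.
open fwdDiff in
lemma leadingCoeff_mem_range_of_countable {α : ℝ} (hα : IsAlgebraic ℚ α) (hα1 : 1 < |α|)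
    {F G : ℝ[X]} (hG : G.natDegree ≠ 0)
    (h : (limitValues (fun k : ℕ =>
      ((F.eval (k : ℝ) * α ^ k + G.eval (k : ℝ) * 1 : ℝ) : UnitAddCircle))).Countable) :
    G.leadingCoeff ∈ Set.range (algebraMap ℚ ℝ) := by
  by_contra hirr
  have hirr : Irrational G.leadingCoeff := hirr
  obtain ⟨p, b, hb, hp, hpR⟩ := exists_int_polynomial_map_eq (minpoly ℚ α)
  -- The integer p(1)^m multiplies the leading coefficient in `a`, so it must not vanish.
  have hp1 : p.eval 1 ≠ 0 := by
    intro h0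
    have h1 := isCoprime_minpoly_X_pow hα hα1 0 1 one_ne_zero
    rw [pow_zero, one_mul, pow_one] at h1
    have h2 : (b • minpoly ℚ α).eval 1 = 0 := by
      rw [← hp, eval_one_map, h0, map_zero]
    rw [eval_smul, smul_eq_zero] at h2
    obtain ⟨s, t, hst⟩ := h1
    have := congrArg (eval 1) hst
    simp [h2.resolve_left hb] at this
  set pR := p.map (Int.castRingHom ℝ) with hpRdef
  obtain ⟨Q, hQ⟩ : X - C α ∣ pR := by
    rw [dvd_iff_isRoot, IsRoot.def, hpR, eval_map_algebraMap, map_zsmul, minpoly.aeval, smul_zero]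
  set n := G.natDegree with hn
  obtain ⟨d, hd⟩ := Nat.exists_eq_succ_of_ne_zero hG
  set m := F.natDegree + 1 with hm
  have hFkill : aeval (shift ℝ ℝ) (pR ^ m) (fun k : ℕ => F.eval (k : ℝ) * α ^ k) = 0 := by
    rw [hQ, mul_pow, mul_comm, map_mul, Module.End.mul_apply, 
      aeval_shift_X_sub_C_pow α m F.eval,
      hm, F.fwdDiff_iter_degree_add_one_eq_zero]
    have : (fun k : ℕ => α ^ (F.natDegree + 1) * (0 : ℝ → ℝ) k * α ^ k) = 0 := by
      ext k; simp
    rw [this, map_zero]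
  have hGdiff : aeval (shift ℝ ℝ) ((X - C 1 : ℝ[X]) ^ n) (fun k : ℕ => G.eval (k : ℝ) * 1) =
      fun k => G.leadingCoeff * n.factorial * 1 ^ k := by
    have := aeval_shift_X_sub_C_pow 1 n G.eval
    simp only [hn, fwdDiff_iter_eval_natDegree, one_pow, one_mul, mul_one] at this ⊢
    exact this
  set a : ℝ := G.leadingCoeff * n.factorial * (pR ^ m).eval 1 with ha
  have hairr : Irrational a := by
    have : a = ((n.factorial * p.eval 1 ^ m : ℤ) : ℝ) * G.leadingCoeff := by
      rw [ha, eval_pow, hpRdef, eval_one_map]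
      push_cast
      rw [eq_intCast]
      ring
    rw [this]
    exact hirr.intCast_mul (mul_ne_zero (by exact_mod_cast n.factorial_ne_zero) (pow_ne_zero _ hp1))
  have hconst : aeval (shift ℝ ℝ) ((X - C 1 : ℝ[X]) ^ n * pR ^ m)
      (fun k : ℕ => F.eval (k : ℝ) * α ^ k + G.eval (k : ℝ) * 1) = fun k => a := by
    change aeval (shift ℝ ℝ) ((X - C 1 : ℝ[X]) ^ n * pR ^ m)
      ((fun k : ℕ => F.eval (k : ℝ) * α ^ k) + fun k : ℕ => G.eval (k : ℝ) * 1) = fun k => a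
    rw [map_add, map_mul, Module.End.mul_apply, hFkill, map_zero, zero_add,
      ← map_mul, mul_comm, map_mul, Module.End.mul_apply, hGdiff, aeval_shift_geom]
    simp [ha]
  have hcount := countable_limitValues_aeval_shift ((X - C 1 : ℤ[X]) ^ d * p ^ m) h
  rw [limitValues_rotation hairr] at hcount
  · exact not_countable_univ_circle hcount
  intro k
  have h1 := congrFun (aeval_shift_coe_circle ((X - C 1 : ℤ[X]) ^ n * p ^ m)
    (fun k : ℕ => F.eval (k : ℝ) * α ^ k + G.eval (k : ℝ) * 1)) k
  have hmap : ((X - C 1 : ℤ[X]) ^ n * p ^ m).map (Int.castRingHom ℝ) =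
      (X - C 1 : ℝ[X]) ^ n * pR ^ m := by simp [hpRdef]
  rw [hmap, hconst] at h1
  have hfactor : (X - C 1 : ℤ[X]) ^ n * p ^ m = (X - C 1) * ((X - C 1) ^ d * p ^ m) := by
    rw [hd, pow_succ', mul_assoc]
  rw [← h1, hfactor, map_mul _ (X - C 1 : ℤ[X]), Module.End.mul_apply]
  simp

/-- A constant term only translates the limit set, so it is required to be 0, a condition preserved
by the descent. -/
theorem coeff_mem_range_of_countable {α : ℝ} (hα : IsAlgebraic ℚ α) (hα1 : 1 < |α|) {F G : ℝ[X]}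
    (hG0 : G.coeff 0 = 0)
    (h : (limitValues (fun k : ℕ =>
      ((F.eval (k : ℝ) * α ^ k + G.eval (k : ℝ) * 1 : ℝ) : UnitAddCircle))).Countable) (n : ℕ) :
    G.coeff n ∈ Set.range (algebraMap ℚ ℝ) := by
  refine coeff_mem_of_leadingCoeff_mem
    (s := Set.range (algebraMap ℚ ℝ)) (Q := fun G => G.coeff 0 = 0 ∧ (limitValues (fun k : ℕ =>
      ((F.eval (k : ℝ) * α ^ k + G.eval (k : ℝ) * 1 : ℝ) : UnitAddCircle))).Countable)
    ⟨0, map_zero _⟩ (fun G hG h => ?_) (fun G hl h => ⟨?_, ?_⟩) ⟨hG0, h⟩ n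
  · refine leadingCoeff_mem_range_of_countable hα hα1 (fun hd => hG ?_) h.2
    rw [eq_C_of_natDegree_eq_zero hd, h.1, map_zero]
  · rw [eraseLead_coeff, h.1, ite_self]
  · obtain ⟨c, hc⟩ := hl
    obtain ⟨v, hv, hveq⟩ := finite_limitValues_eraseLead (w := fun _ => 1) (G := G)
      (u := fun k => F.eval (k : ℝ) * α ^ k) (by
        rw [← hc]
        exact finite_limitValues_rat_mul_pow c G.natDegree)
    rw [hveq]
    exact countable_limitValues_add h.2 hv.countable

/-! ### Assembly of the equivalence. -/

theorem corollary1p6 (α : ℝ) (hα : IsAlgebraic ℚ α) (hα1 : 1 < |α|)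
    (F G : Polynomial ℝ) (hF : F ≠ 0) (E : Set UnitAddCircle)
    (hE : E = limitValues
      (fun k : ℕ => ((F.eval (k : ℝ) * α ^ k + G.eval (k : ℝ) : ℝ) : UnitAddCircle))) :
    (E.Finite ↔
      IsPisot |α| ∧
      F ∈ Polynomial.lifts (algebraMap (IntermediateField.adjoin ℚ {α}) ℝ) ∧
      G - Polynomial.C (G.eval 0) ∈ Polynomial.lifts (algebraMap ℚ ℝ)) ∧
    (G - Polynomial.C (G.eval 0) ∉ Polynomial.lifts (algebraMap ℚ ℝ) → ¬ E.Countable) := by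
  set H := G - Polynomial.C (G.eval 0) with hH
  have hconst : (limitValues (fun _ : ℕ => ((G.eval 0 : ℝ) : UnitAddCircle))).Finite :=
    (Set.finite_singleton _).subset (limitValues_subset_of_tendsto tendsto_const_nhds)
  have hsplit : (fun k : ℕ =>
      ((F.eval (k : ℝ) * α ^ k + G.eval (k : ℝ) : ℝ) : UnitAddCircle)) =
      (fun k : ℕ => ((F.eval (k : ℝ) * α ^ k + H.eval (k : ℝ) * 1 : ℝ) : UnitAddCircle)) +
        fun _ : ℕ => ((G.eval 0 : ℝ) : UnitAddCircle) := by
    ext k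
    rw [Pi.add_apply, ← AddCircle.coe_add]
    congr 1
    simp only [hH, eval_sub, eval_C]
    ring
  have hH0 : H.coeff 0 = 0 := by simp [hH, coeff_zero_eq_eval_zero]
  have hrat : E.Countable → ∀ n, H.coeff n ∈ Set.range (algebraMap ℚ ℝ) := by
    intro hc
    refine coeff_mem_range_of_countable hα hα1 (F := F) hH0 ?_
    have := countable_limitValues_add (hE ▸ hc) (finite_limitValues_neg hconst).countable
    rw [hsplit] at this
    rwa [← sub_eq_add_neg, add_sub_cancel_right] at this
  have hfinH : (∀ n, H.coeff n ∈ Set.range (algebraMap ℚ ℝ)) →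
      (limitValues (fun k : ℕ => ((H.eval (k : ℝ) * 1 : ℝ) : UnitAddCircle))).Finite := by
    refine finite_limitValues_eval_mul (w := fun _ => 1) ?_
    rintro _ ⟨c, rfl⟩ n
    exact finite_limitValues_rat_mul_pow c n
  have hsplit' : (fun k : ℕ =>
      ((F.eval (k : ℝ) * α ^ k + G.eval (k : ℝ) : ℝ) : UnitAddCircle)) =
      (fun k : ℕ => ((F.eval (k : ℝ) * α ^ k : ℝ) : UnitAddCircle)) +
      ((fun k : ℕ => ((H.eval (k : ℝ) * 1 : ℝ) : UnitAddCircle)) +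
        fun _ : ℕ => ((G.eval 0 : ℝ) : UnitAddCircle)) := by
    rw [hsplit, ← add_assoc]
    rfl
  rw [isPisot_abs_iff hα1, lifts_iff_coeff_lifts, lifts_iff_coeff_lifts]
  refine ⟨⟨fun hfin => ?_, fun ⟨hP, hFK, hHQ⟩ => ?_⟩, fun hn hc => hn (hrat hc)⟩
  -- Rationality of `H` comes first: its contribution then has finitely many limit values and can be
  -- subtracted to isolate the exponential part.
  · have hHQ := hrat hfin.countable
    have hFfin : (limitValues
        (fun k : ℕ => ((F.eval (k : ℝ) * α ^ k : ℝ) : UnitAddCircle))).Finite := by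
      have := finite_limitValues_add (hE ▸ hfin)
        (finite_limitValues_neg (finite_limitValues_add (hfinH hHQ) hconst))
      rw [hsplit'] at this
      rwa [← sub_eq_add_neg, add_sub_cancel_right] at this
    have hP := (leadingCoeff_mem_adjoin hα hα1 hF hFfin).2
    exact ⟨hP, fun n => ⟨⟨_, coeff_mem_adjoin_of_finite hα hα1 hFfin hP n⟩, rfl⟩, hHQ⟩
  · rw [hE, hsplit']
    refine finite_limitValues_add ?_ (finite_limitValues_add (hfinH hHQ) hconst)
    refine finite_limitValues_eval_mul (s := Set.range _) ?_ hFK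
    rintro _ ⟨c, rfl⟩ n
    exact hP.finite_limitValues_mul_pow c.2 n
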